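/- **Conventions.** Let $\Sigma$ be a finite tape alphabet with a blank symbol $\Box$ and at least one other symbol, and $Q$ a finite set of states. A *plain configuration* is a triple $\langle\alpha,q,\beta\rangle\in\Sigma^*\times Q\times\Sigma^*$ (content to the left of the head, state, content from the current cell on to the right), where $\alpha$ and $\Box\alpha$, and $\beta$ and $\beta\Box$, are identified; the first symbol of $\beta$ is the current symbol. For $C$ with state $q$ and current symbol $u$, let $C_{p,v,d}$ be obtained from $C$ by changing the state to $p$, replacing $u$ by $v$ and then moving the head one cell in direction $d\in\{L,R\}$. For a set $B$, $\ell^2(B)$ is the Hilbert space of square-summable families $B\to\mathbb C$, with basis vectors $|C\rangle$, $C\in B$. *Bernstein–Vazirani machines.* Such a machine $M=\langle\Sigma,Q,\delta,q_0,q_f\rangle$ has states $q_0\ne q_f$ and a function $\delta:Q\times\Sigma\to\mathbb C^{Q\times\Sigma\times\{L,R\}}$. Its evolution operator $U_M$ is the bounded operator on $\ell^2$ of the set of plain configurations with $U_M|C\rangle=\sum_{p,v,d}\delta(q,u)(p,v,d)\,|C_{p,v,d}\rangle$. A configuration is initial (final) if its state is $q_0$ ($q_f$); a vector $\phi$ contains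 $D$ if $\phi(D)\neq0$. For an initial configuration $C$, *$M$ with input $|C\rangle$ halts in $k$ steps in $|\phi\rangle$* if $k$ is the least $j$ such that $U_M^j|C\rangle$ contains a final configuration, $|\phi\rangle=U_M^k|C\rangle$, and $|\phi\rangle$ contains only final configurations. $M$ is * *well-formed* if $U_M$ is unitary; * in *normal form* if, for all $a\in\Sigma$, $\delta(q_f,a)(q_0,a,R)=1$ and $\delta(q_f,a)(p,b,d)=0$ for $(p,b,d)\ne(q_0,a,R)$; * *stationary* if, whenever it is started in $q_0$ on a finite word of non-blank symbols (the head on the first symbol, all other cells blank) and a final configuration occurs, at the first time $k$ at which one occurs all configurations in the superposition are final and, in the evolution that also keeps track of the position of the head, the head is on the start cell in all of them. *QTMs with counter.* A pre-QTM $M'=\langle\Sigma,Q,Q_s,Q_t,\delta_0,q_i,q_f\rangle$ has disjoint sets $Q_s\ni q_i$ of source states and $Q_t\ni q_f$ of target states, and a function $\delta_0:(Q\setminus Q_t)\times\Sigma\to\mathbb C^{(Q\setminus Q_s)\times\Sigma\times\{L,R\}}$. Its configurations are pairs $\langle C,n\rangle$ of a plain configuration and a counter $n\in\mathbb N$, with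 $n=0$ unless the state is in $Q_s\cup Q_t$. Its evolution operator $U_{M'}$ is the bounded operator on $\ell^2$ of the set of these configurations such that, $q$ being the state and $u$ the current symbol of $C$: $U_{M'}|C,n\rangle=|C,n+1\rangle$ if $q\in Q_t$; $U_{M'}|C,n\rangle=|C,n-1\rangle$ if $q\in Q_s$ and $n>0$; and $U_{M'}|C,0\rangle=\sum_{p\notin Q_s,\,v,\,d}\delta_0(q,u)(p,v,d)\,|C_{p,v,d},0\rangle$ if $q\notin Q_t$. $M'$ is a *QTM* if $U_{M'}$ is unitary. Superpositions of plain configurations are regarded as superpositions of configurations of $M'$ through $|C\rangle\mapsto|C,0\rangle$. **Theorem.** Let $M=\langle\Sigma,Q,\delta,q_0,q_f\rangle$ be a well-formed, stationary Bernstein–Vazirani machine in normal form. Then there is a QTM $M'=\langle\Sigma,Q,\{q_0\},\{q_f\},\delta_0,q_0,q_f\rangle$, with $q_0$ as its only source state and initial state, $q_f$ as its only target state and final state, and $\delta_0$ the restriction of $\delta$, i.e. $\delta_0(q,a)(p,b,d)=\delta(q,a)(p,b,d)$ for all $q\neq q_f$, $p\ne q_0$, $a,b\in\Sigma$, $d\in\{L,R\}$,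 such that, for each initial configuration $C$ and each $k$: if $M$ with input $|C\rangle$ halts in $k$ steps in $|\phi\rangle=U_M^k|C\rangle$, then $U_{M'}^k|C\rangle=|\phi\rangle$. -/

import Mathlib

open Turing

noncomputable section

namespace QTM

/-! ### The Hilbert space `ℓ²(B)` and its computational basis -/

/-- The Hilbert space of square summable `B`-indexed families of complex numbers. -/
abbrev Hilb (B : Type*) : Type _ := lp (fun _ : B => ℂ) 2

open Classical in
/-- The base vector `|C⟩`: the function equal to `1` at `C` and to `0` elsewhere. -/
def ket {B : Type*} (C : B) : Hilb B := lp.single 2 C (1 : ℂ)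

open Classical in
theorem ket_apply {B : Type*} (C D : B) : ket C D = if D = C then 1 else 0 := by
  rw [ket, lp.single_apply, Pi.single_apply]

theorem inner_ket_left {B : Type*} (C : B) (φ : Hilb B) : inner ℂ (ket C) φ = φ C := by
  classical
  rw [ket, lp.inner_single_left]
  simp

open Classical in
theorem orthonormal_ket {B B' : Type*} (f : B → B') (hf : Function.Injective f) :
    Orthonormal ℂ (fun C => ket (f C)) := by
  rw [orthonormal_iff_ite]
  intro i j
  rw [ket, lp.inner_single_left, ket_apply]
  by_cases h : i = j <;> simp [h, hf.eq_iff]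

/-- The linear isometry `ℓ²(B) → ℓ²(B')` with `|C⟩ ↦ |f C⟩` induced by an injection `f`. -/
def mapKet {B B' : Type*} (f : B → B') (hf : Function.Injective f) : Hilb B →ₗᵢ[ℂ] Hilb B' :=
  (orthonormal_ket f hf).orthogonalFamily.linearIsometry

theorem mapKet_ket {B B' : Type*} (f : B → B') (hf : Function.Injective f) (C : B) :
    mapKet f hf (ket C) = ket (f C) := by
  classical
  have h := (orthonormal_ket f hf).orthogonalFamily.linearIsometry_apply_single (i := C) (1 : ℂ)
  have e : (ket C : Hilb B) = lp.single 2 C (1 : ℂ) := by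
    unfold ket; congr
  rw [mapKet, e, h]
  simp

open Classical in
/-- A partial injection `f` of base vectors extends to a bounded operator. -/
theorem exists_partial {B B' : Type*} (S : Set B) (f : S → B') (hf : Function.Injective f) :
    ∃ T : Hilb B →L[ℂ] Hilb B', ∀ C, T (ket C) = if h : C ∈ S then ket (f ⟨C, h⟩) else 0 := by
  refine ⟨(mapKet f hf).toContinuousLinearMap.comp
    (ContinuousLinearMap.adjoint
      (mapKet (Subtype.val : S → B) Subtype.val_injective).toContinuousLinearMap), fun C => ?_⟩
  have key : ContinuousLinearMap.adjoint
      (mapKet (Subtype.val : S → B) Subtype.val_injective).toContinuousLinearMap (ket C)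
      = if h : C ∈ S then ket (⟨C, h⟩ : S) else 0 := by
    ext s
    rw [← inner_ket_left, ContinuousLinearMap.adjoint_inner_right]
    have h2 : (mapKet (Subtype.val : S → B) Subtype.val_injective).toContinuousLinearMap (ket s)
        = ket s.1 := mapKet_ket _ Subtype.val_injective _
    rw [h2, inner_ket_left, ket_apply]
    by_cases h : C ∈ S
    · rw [dif_pos h, ket_apply]
      simp [Subtype.ext_iff]
    · rw [dif_neg h]
      have : s.1 ≠ C := fun e => h (e ▸ s.2)
      simp [this]
  rw [ContinuousLinearMap.comp_apply, key]
  by_cases h : C ∈ S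
  · rw [dif_pos h, dif_pos h]
    exact mapKet_ket _ hf _
  · rw [dif_neg h, dif_neg h, map_zero]

/-- A bounded operator is determined by its values on the computational basis. -/
theorem ext_ket {B B' : Type*} {T T' : Hilb B →L[ℂ] Hilb B'}
    (h : ∀ C, T (ket C) = T' (ket C)) : T = T' := by
  classical
  ext1 φ
  have hφ := lp.hasSum_single (p := 2) (by norm_num) φ
  have e : ∀ C : B, lp.single 2 C (φ C) = φ C • (ket C : Hilb B) := by
    intro C
    ext D
    rw [lp.coeFn_smul, Pi.smul_apply, ket_apply, lp.single_apply, Pi.single_apply]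
    split_ifs <;> simp
  rw [← (hφ.map T T.continuous).tsum_eq, ← (hφ.map T' T'.continuous).tsum_eq]
  refine tsum_congr fun C => ?_
  simp only [Function.comp_apply, e, map_smul, h]

/-! ### Plain configurations -/

instance : Fintype Dir := ⟨{Dir.left, Dir.right}, fun d => by cases d <;> simp⟩

/-- A plain configuration `⟨α, q, β⟩`, up to blanks at the far ends of `α` and `β`: a state and a
tape of which all but finitely many cells are blank. `Turing.Tape Γ` consists of the current symbol
and of the tape contents to its left and to its right, up to trailing `default`s; the blank
symbol `□` is `default : Γ`. -/
@[ext]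
structure PlainConfig (Γ Q : Type*) [Inhabited Γ] where
  /-- the current state -/
  state : Q
  /-- the tape content, seen from the current cell -/
  tape : Tape Γ

namespace PlainConfig

variable {Γ Q : Type*} [Inhabited Γ]

/-- `C_{p,v,d}`: enter the state `p`, write `v` in the current cell, move the head by `d`. -/
def next (C : PlainConfig Γ Q) (x : Q × Γ × Dir) : PlainConfig Γ Q :=
  ⟨x.1, (C.tape.write x.2.1).move x.2.2⟩

end PlainConfig

theorem tape_step_inj {Γ : Type*} [Inhabited Γ] {T T' : Tape Γ} {v : Γ} {d : Dir}
    (hh : T.head = T'.head) (h : (T.write v).move d = (T'.write v).move d) : T = T' := by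
  have h1 : T.write v = T'.write v := by
    cases d
    · simpa using congrArg (Tape.move Dir.right) h
    · simpa using congrArg (Tape.move Dir.left) h
  have h2 : T.left = T'.left ∧ T.right = T'.right := by
    simpa [Tape.write] using h1
  cases T; cases T'
  simp_all

/-! ### The quantum Turing machines of Bernstein and Vazirani -/

/-- A quantum Turing machine in the sense of Bernstein and Vazirani, with tape alphabet `Γ`,
set of states `Q` and transition function `δ`; the initial and the final state are distinct. No
condition is imposed on `δ` yet. -/
structure BVMachine (Γ Q : Type*) where
  /-- `δ q u (p, v, d)` is the amplitude, in state `q` and reading `u`, of entering `p`, writing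
  `v` and moving by `d` -/
  δ : Q → Γ → Q × Γ × Dir → ℂ
  /-- the initial state -/
  q₀ : Q
  /-- the final state -/
  qf : Q
  q₀_ne_qf : q₀ ≠ qf

namespace BVMachine

variable {Γ Q : Type*} [Inhabited Γ] [Fintype Γ] [Fintype Q] (M : BVMachine Γ Q)

/-- The superposition reached in one step from the base vector `|C⟩`. -/
def step (C : PlainConfig Γ Q) : Hilb (PlainConfig Γ Q) :=
  ∑ x : Q × Γ × Dir, M.δ C.state C.tape.head x • ket (C.next x)

theorem exists_timeEvolution :
    ∃ U : Hilb (PlainConfig Γ Q) →L[ℂ] Hilb (PlainConfig Γ Q), ∀ C, U (ket C) = M.step C := by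
  classical
  have h : ∀ i : (Q × Γ) × (Q × Γ × Dir),
      ∃ T : Hilb (PlainConfig Γ Q) →L[ℂ] Hilb (PlainConfig Γ Q), ∀ C : PlainConfig Γ Q,
        T (ket C) = if (C.state, C.tape.head) = i.1 then ket (C.next i.2) else 0 := by
    intro i
    obtain ⟨T, hT⟩ := exists_partial {C : PlainConfig Γ Q | (C.state, C.tape.head) = i.1}
      (fun C => C.1.next i.2) (by
        rintro ⟨C, hC⟩ ⟨D, hD⟩ h
        simp only [Set.mem_ofPred_eq] at hC hD
        have hs := hC.trans hD.symm
        simp only [Prod.mk.injEq] at hs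
        have ht := congrArg PlainConfig.tape h
        exact Subtype.ext (PlainConfig.ext hs.1 (tape_step_inj hs.2 ht)))
    refine ⟨T, fun C => ?_⟩
    rw [hT]
    simp only [Set.mem_ofPred_eq]
    split_ifs <;> rfl
  choose T hT using h
  refine ⟨∑ i, M.δ i.1.1 i.1.2 i.2 • T i, fun C => ?_⟩
  rw [sum_apply, Fintype.sum_prod_type_right]
  refine Finset.sum_congr rfl fun x _ => ?_
  rw [Finset.sum_eq_single (C.state, C.tape.head)]
  · simp [hT]
  · rintro b - hb
    simp [hT, hb.symm]
  · simp

/-- The time evolution operator `U_M`: the (unique) bounded operator on `ℓ²` of the set of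
configurations that extends the one-step evolution of the base vectors. -/
def timeEvolution : Hilb (PlainConfig Γ Q) →L[ℂ] Hilb (PlainConfig Γ Q) :=
  Classical.choose M.exists_timeEvolution

theorem timeEvolution_ket (C : PlainConfig Γ Q) : M.timeEvolution (ket C) = M.step C :=
  Classical.choose_spec M.exists_timeEvolution C

/-- `M` is well-formed when its time evolution operator is unitary. -/
def IsWellFormed : Prop :=
  M.timeEvolution ∈ unitary (Hilb (PlainConfig Γ Q) →L[ℂ] Hilb (PlainConfig Γ Q))

open Classical in
/-- `M` is in normal form when, in the final state and whatever the current symbol `a` is, it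
enters the initial state, leaves `a` unchanged and moves to the right, with amplitude `1` (and
makes any other transition with amplitude `0`). -/
def IsNormalForm : Prop :=
  ∀ a x, M.δ M.qf a x = if x = (M.q₀, a, Dir.right) then 1 else 0

/-- `k = min {j | U_M^j |C⟩ contains a final configuration}`. -/
def FirstFinal (C : PlainConfig Γ Q) (k : ℕ) : Prop :=
  IsLeast {j : ℕ | ∃ D, D.state = M.qf ∧ (M.timeEvolution ^ j) (ket C) D ≠ 0} k

/-- With input `C`, the machine `M` halts in `k` steps in `φ`: `φ = U_M^k |C⟩` contains only final
configurations, and `k` is the least number of steps after which a final configuration occurs. -/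
def HaltsIn (C : PlainConfig Γ Q) (k : ℕ) (φ : Hilb (PlainConfig Γ Q)) : Prop :=
  M.FirstFinal C k ∧ φ = (M.timeEvolution ^ k) (ket C) ∧ ∀ D, φ D ≠ 0 → D.state = M.qf

/-- The displacement of the head caused by a move. -/
def displacement : Dir → ℤ
  | Dir.left => -1
  | Dir.right => 1

/-- The one-step evolution of superpositions of located configurations: `(C, z)` is the
configuration `C` with its head `z` cells to the right of the start cell. -/
def locatedStep : (PlainConfig Γ Q × ℤ →₀ ℂ) →ₗ[ℂ] (PlainConfig Γ Q × ℤ →₀ ℂ) :=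
  Finsupp.linearCombination ℂ fun Cz : PlainConfig Γ Q × ℤ =>
    ∑ x : Q × Γ × Dir,
      Finsupp.single (Cz.1.next x, Cz.2 + displacement x.2.2) (M.δ Cz.1.state Cz.1.tape.head x)

/-- `M` is stationary: for every input word `w` without blanks, written on an otherwise blank tape
with the head on its first symbol, if `k` is the first time at which a final configuration
occurs, then at time `k` all configurations are final and the head is on the start cell in each
of them. (Nothing is required when no final configuration ever occurs, or of initial
configurations whose tape is not of this form; so this is implied by the condition that asks the
same of all initial configurations, and by the one that asks in addition that `M` halt.) -/
def IsStationary : Prop :=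
  ∀ w : List Γ, default ∉ w → ∀ k : ℕ, M.FirstFinal ⟨M.q₀, Tape.mk₁ w⟩ k →
    (∀ D, (M.timeEvolution ^ k) (ket ⟨M.q₀, Tape.mk₁ w⟩) D ≠ 0 → D.state = M.qf) ∧
    ∀ D z, (M.locatedStep ^ k) (Finsupp.single (⟨M.q₀, Tape.mk₁ w⟩, 0) 1) (D, z) ≠ 0 → z = 0

end BVMachine

/-! ### Quantum Turing machines with source and target states and a counter -/

/-- A pre quantum Turing machine, with tape alphabet `Γ`, set of states `Q`, source states `Qs`,
target states `Qt` (disjoint from `Qs`), initial state `qi` and final state `qf`. -/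
structure PreQTM (Γ Q : Type*) where
  /-- the source states -/
  Qs : Set Q
  /-- the target states -/
  Qt : Set Q
  disjoint : Disjoint Qs Qt
  /-- the quantum transition function -/
  δ₀ : {q // q ∉ Qt} → Γ → {p // p ∉ Qs} × Γ × Dir → ℂ
  /-- the initial state -/
  qi : Q
  qi_mem : qi ∈ Qs
  /-- the final state -/
  qf : Q
  qf_mem : qf ∈ Qt

namespace PreQTM

variable {Γ Q : Type*} [Inhabited Γ]

/-- A configuration `⟨α, q, β, n⟩`: a plain configuration with a counter `n`, which is `0` unless
the state is a source or a target state. -/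
@[ext]
structure Config (M : PreQTM Γ Q) where
  /-- the underlying plain configuration -/
  plain : PlainConfig Γ Q
  /-- the counter -/
  counter : ℕ
  counter_eq_zero : plain.state ∉ M.Qs ∪ M.Qt → counter = 0

variable (M : PreQTM Γ Q)

/-- The configuration with counter `0` over a plain configuration. -/
def zeroConfig (C : PlainConfig Γ Q) : M.Config := ⟨C, 0, fun _ => rfl⟩

theorem zeroConfig_injective : Function.Injective M.zeroConfig :=
  fun _ _ h => congrArg Config.plain h

/-- The inclusion of the superpositions of plain configurations into those of configurations of
`M`, which maps `|C⟩` to `|C, 0⟩`. -/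
def embed : Hilb (PlainConfig Γ Q) →ₗᵢ[ℂ] Hilb M.Config :=
  mapKet M.zeroConfig M.zeroConfig_injective

variable {M} in
/-- `C_{+1}`: the counter of a target configuration is increased by `1`. -/
def Config.incr (C : M.Config) (h : C.plain.state ∈ M.Qt) : M.Config :=
  ⟨C.plain, C.counter + 1, fun h' => absurd (Or.inr h) h'⟩

variable {M} in
/-- `C_{-1}`: the counter is decreased by `1` (used for positive counters only). -/
def Config.decr (C : M.Config) : M.Config :=
  ⟨C.plain, C.counter - 1, fun h => by rw [C.counter_eq_zero h]⟩

variable {M} in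
/-- `C_{p,v,d}` with counter `0`, for `p` not a source state. -/
def Config.next (C : M.Config) (x : {p // p ∉ M.Qs} × Γ × Dir) : M.Config :=
  M.zeroConfig (C.plain.next (x.1.1, x.2.1, x.2.2))

variable [Fintype Γ] [Fintype Q]

open Classical in
/-- The superposition `W_M |C⟩` reached in one step from the base vector `|C⟩`: on target
configurations the counter is increased; on other configurations with counter `0` the transition
function applies; in the remaining case, a source configuration with positive counter, the counter
is decreased. -/
def step (C : M.Config) : Hilb M.Config :=
  if h : C.plain.state ∈ M.Qt then ket (C.incr h)
  else if C.counter = 0 then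
    ∑ x : {p // p ∉ M.Qs} × Γ × Dir, M.δ₀ ⟨C.plain.state, h⟩ C.plain.tape.head x • ket (C.next x)
  else ket C.decr

theorem exists_timeEvolution :
    ∃ U : Hilb M.Config →L[ℂ] Hilb M.Config, ∀ C, U (ket C) = M.step C := by
  classical
  obtain ⟨Tt, hTt⟩ := exists_partial {C : M.Config | C.plain.state ∈ M.Qt}
    (fun C => C.1.incr C.2) (by
      rintro ⟨C, hC⟩ ⟨D, hD⟩ h
      have h1 := congrArg Config.plain h
      have h2 := congrArg Config.counter h
      simp only [Config.incr, Nat.add_right_cancel_iff] at h1 h2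
      exact Subtype.ext (Config.ext h1 h2))
  obtain ⟨Ts, hTs⟩ := exists_partial
    {C : M.Config | C.plain.state ∉ M.Qt ∧ C.counter ≠ 0}
    (fun C => C.1.decr) (by
      rintro ⟨C, hC⟩ ⟨D, hD⟩ h
      have h1 := congrArg Config.plain h
      have h2 := congrArg Config.counter h
      simp only [Config.decr] at h1 h2
      have h3 : C.counter ≠ 0 := hC.2
      have h4 : D.counter ≠ 0 := hD.2
      change C.counter - 1 = D.counter - 1 at h2
      have h5 : C.counter = D.counter := by omega
      exact Subtype.ext (Config.ext h1 h5))
  have h : ∀ i : ({q // q ∉ M.Qt} × Γ) × ({p // p ∉ M.Qs} × Γ × Dir),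
      ∃ T : Hilb M.Config →L[ℂ] Hilb M.Config, ∀ C : M.Config,
        T (ket C) = if C.counter = 0 ∧ C.plain.state = i.1.1.1 ∧ C.plain.tape.head = i.1.2
          then ket (C.next i.2) else 0 := by
    intro i
    obtain ⟨T, hT⟩ := exists_partial {C : M.Config | C.counter = 0 ∧
        C.plain.state = i.1.1.1 ∧ C.plain.tape.head = i.1.2}
      (fun C => C.1.next i.2) (by
        rintro ⟨C, hC⟩ ⟨D, hD⟩ h
        have ht := congrArg PlainConfig.tape (congrArg Config.plain h)
        exact Subtype.ext (Config.ext (PlainConfig.ext (hC.2.1.trans hD.2.1.symm)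
          (tape_step_inj (hC.2.2.trans hD.2.2.symm) ht)) (hC.1.trans hD.1.symm)))
    refine ⟨T, fun C => ?_⟩
    rw [hT]
    simp only [Set.mem_ofPred_eq]
    split_ifs <;> rfl
  choose T hT using h
  refine ⟨Tt + Ts + ∑ i, M.δ₀ i.1.1 i.1.2 i.2 • T i, fun C => ?_⟩
  rw [add_apply, add_apply,
    sum_apply, hTt, hTs]
  unfold step
  by_cases h : C.plain.state ∈ M.Qt
  · have h0 : ∀ i ∈ (Finset.univ : Finset (({q // q ∉ M.Qt} × Γ) × ({p // p ∉ M.Qs} × Γ × Dir))),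
        (M.δ₀ i.1.1 i.1.2 i.2 • T i) (ket C) = 0 := by
      rintro i -
      have : C.plain.state ≠ i.1.1.1 := fun e => i.1.1.2 (e ▸ h)
      simp [hT, this]
    rw [Finset.sum_eq_zero h0]
    simp [h]
  · by_cases h0 : C.counter = 0
    · simp only [Set.mem_ofPred_eq, h, h0, not_false_eq_true, ne_eq, not_true_eq_false, and_false,
        dite_false, if_true, zero_add]
      rw [Fintype.sum_prod_type_right]
      refine Finset.sum_congr rfl fun x _ => ?_
      rw [Finset.sum_eq_single (⟨C.plain.state, h⟩, C.plain.tape.head)]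
      · simp [hT, h0]
      · rintro b - hb
        have : ¬ (C.plain.state = b.1.1 ∧ C.plain.tape.head = b.2) := fun e =>
          hb (Prod.ext (Subtype.ext e.1.symm) e.2.symm)
        simp [hT, this]
      · simp
    · simp [hT, h, h0]

/-- The time evolution operator `U_M`: the (unique) bounded operator on `ℓ²` of the set of
configurations that extends the one-step evolution of the base vectors. -/
def timeEvolution : Hilb M.Config →L[ℂ] Hilb M.Config :=
  Classical.choose M.exists_timeEvolution

theorem timeEvolution_ket (C : M.Config) : M.timeEvolution (ket C) = M.step C :=
  Classical.choose_spec M.exists_timeEvolution C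

/-- A pre quantum Turing machine is a quantum Turing machine when its time evolution operator is
unitary. -/
def IsQTM : Prop :=
  M.timeEvolution ∈ unitary (Hilb M.Config →L[ℂ] Hilb M.Config)

end PreQTM

end QTM

end

/-! By normal form, `U_M` carries the final base vectors bijectively onto the initial ones, by a
shift of the head. As `U_M` is unitary, it must carry the closed span of the non-final base vectors
onto the orthogonal complement of the initial ones, that is, onto the closed span of the non-initial
ones (`timeEvolution_apply_initial`, `exists_preimage_of_ne_initial`). Dropping the transitions into
`q₀` therefore changes nothing on non-final vectors. The counter replaces the jump from `qf` to `q₀`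
by two shifts: initial configurations count down to `0`, final ones count up from `0`. The non-final
configurations with counter `0` reach unitarily the non-initial part with counter `0`; the shifts
reach bijectively all initial configurations and the final ones with positive counter. These three
images are mutually orthogonal and fill the space, so `U_{M'}` is unitary. Up to the first time a
final configuration occurs, only non-final vectors are evolved, and the two machines agree. -/

namespace QTM

/-! ### Bounded operators and base vectors -/

open Classical in
/-- Two bounded operators agree at `φ` if they agree on the base vectors that `φ` contains. -/
theorem apply_eq_of_support {B E : Type*} [NormedAddCommGroup E] [NormedSpace ℂ E]
    {T T' : Hilb B →L[ℂ] E} {φ : Hilb B} (h : ∀ C, φ C ≠ 0 → T (ket C) = T' (ket C)) :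
    T φ = T' φ := by
  have hφ := lp.hasSum_single (p := 2) (by norm_num) φ
  have e : ∀ C : B, lp.single 2 C (φ C) = φ C • (ket C : Hilb B) := by
    intro C
    ext D
    rw [lp.coeFn_smul, Pi.smul_apply, ket_apply, lp.single_apply, Pi.single_apply]
    split_ifs <;> simp
  rw [← (hφ.map T T.continuous).tsum_eq, ← (hφ.map T' T'.continuous).tsum_eq]
  refine tsum_congr fun C => ?_
  by_cases hC : φ C = 0
  · simp [hC]
  · simp only [Function.comp_apply, e, map_smul, h C hC]

theorem inner_ket_right {B : Type*} (φ : Hilb B) (C : B) :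
    inner ℂ φ (ket C) = (starRingEnd ℂ) (φ C) := by
  rw [← inner_conj_symm, inner_ket_left]

theorem mapKet_apply {B B' : Type*} (f : B → B') (hf : Function.Injective f) (φ : Hilb B)
    (C : B) : mapKet f hf φ (f C) = φ C := by
  rw [← inner_ket_left, ← mapKet_ket f hf, LinearIsometry.inner_map_map, inner_ket_left]

theorem mapKet_apply_of_notMem_range {B B' : Type*} (f : B → B') (hf : Function.Injective f)
    (φ : Hilb B) {D : B'} (hD : D ∉ Set.range f) : mapKet f hf φ D = 0 := by
  -- The coordinate at `D` is a bounded functional, so its vanishing can be tested on base vectors.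
  have h : ((innerSL ℂ (ket D)).comp (mapKet f hf).toContinuousLinearMap) φ
      = (0 : Hilb B →L[ℂ] ℂ) φ := by
    refine apply_eq_of_support fun C _ => ?_
    have h2 : inner ℂ (ket D) (mapKet f hf (ket C)) = (0 : ℂ) := by
      rw [mapKet_ket, inner_ket_left, ket_apply, if_neg]
      exact fun e => hD ⟨C, e.symm⟩
    simpa using h2
  rw [← inner_ket_left]
  simpa using h

/-- An operator whose columns are orthonormal and whose range contains the computational basis is
unitary. -/
theorem mem_unitary_of_ket {B : Type*} {T : Hilb B →L[ℂ] Hilb B}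
    (h : ∀ C D, inner ℂ (T (ket C)) (T (ket D)) = inner ℂ (ket C) (ket D : Hilb B))
    (hs : ∀ D, ∃ ψ, T ψ = ket D) : T ∈ unitary (Hilb B →L[ℂ] Hilb B) := by
  have h1 : star T * T = 1 := by
    refine ext_ket fun D => ?_
    ext C
    rw [← inner_ket_left, ContinuousLinearMap.star_eq_adjoint, mul_apply_eq_comp,
      ContinuousLinearMap.adjoint_inner_right, h, inner_ket_left]
    rfl
  refine Unitary.mem_iff.2 ⟨h1, ext_ket fun D => ?_⟩
  obtain ⟨ψ, hψ⟩ := hs D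
  -- Applying `T` to `T* T ψ = ψ` gives `T T* |D⟩ = |D⟩`.
  have h2 := congrArg T (congrArg (fun S : Hilb B →L[ℂ] Hilb B => S ψ) h1)
  simpa [hψ] using h2

/-! ### The machine with counter -/

namespace BVMachine

variable {Γ Q : Type*} [Inhabited Γ] {M : BVMachine Γ Q}

variable (M) in
/-- The QTM with counter whose transition function is the restriction of that of `M`, with the
initial state as its only source state and the final state as its only target state. -/
def toPreQTM : PreQTM Γ Q where
  Qs := {M.q₀}
  Qt := {M.qf}
  disjoint := Set.disjoint_singleton.2 M.q₀_ne_qf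
  δ₀ q a x := M.δ q.1 a (x.1.1, x.2.1, x.2.2)
  qi := M.q₀
  qi_mem := rfl
  qf := M.qf
  qf_mem := rfl

theorem embed_apply (φ : Hilb (PlainConfig Γ Q)) (C : M.toPreQTM.Config) :
    M.toPreQTM.embed φ C = if C.counter = 0 then φ C.plain else 0 := by
  split_ifs with h
  · have e : C = M.toPreQTM.zeroConfig C.plain := PreQTM.Config.ext rfl h
    conv_lhs => rw [e]
    exact mapKet_apply _ M.toPreQTM.zeroConfig_injective _ _
  · refine mapKet_apply_of_notMem_range _ M.toPreQTM.zeroConfig_injective _ ?_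
    rintro ⟨D, rfl⟩
    exact h rfl

/-- A configuration with positive counter is initial or final. -/
theorem state_eq_initial {C : M.toPreQTM.Config} (hC : C.plain.state ≠ M.qf)
    (h0 : C.counter ≠ 0) : C.plain.state = M.q₀ := by
  by_contra h
  exact h0 (C.counter_eq_zero (by rintro (h' | h') <;> [exact h h'; exact hC h']))

variable [Fintype Γ] [Fintype Q]

/-! ### Final and initial configurations under `U_M` -/

theorem IsWellFormed.inner_map_map (hwf : M.IsWellFormed) (φ ψ : Hilb (PlainConfig Γ Q)) :
    inner ℂ (M.timeEvolution φ) (M.timeEvolution ψ) = inner ℂ φ ψ := by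
  rw [← ContinuousLinearMap.adjoint_inner_right, ← ContinuousLinearMap.star_eq_adjoint,
    ← mul_apply_eq_comp, (Unitary.mem_iff.1 hwf).1]
  rfl

theorem IsNormalForm.timeEvolution_final (hnf : M.IsNormalForm) {C : PlainConfig Γ Q}
    (hC : C.state = M.qf) :
    M.timeEvolution (ket C) = ket ⟨M.q₀, C.tape.move Dir.right⟩ := by
  classical
  rw [timeEvolution_ket, step, Finset.sum_eq_single (M.q₀, C.tape.head, Dir.right)]
  · simp [hC, hnf C.tape.head, PlainConfig.next]
  · rintro x - hx
    simp [hC, hnf C.tape.head, hx]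
  · simp

/-- Every initial configuration is the successor of a final one. -/
theorem IsNormalForm.exists_final (hnf : M.IsNormalForm) {D : PlainConfig Γ Q}
    (hD : D.state = M.q₀) :
    ∃ C : PlainConfig Γ Q, C.state = M.qf ∧ M.timeEvolution (ket C) = ket D := by
  refine ⟨⟨M.qf, D.tape.move Dir.left⟩, rfl, ?_⟩
  rw [hnf.timeEvolution_final rfl]
  congr 1
  exact PlainConfig.ext hD.symm (by simp)

/-- A non-final configuration does not evolve into initial ones. -/
theorem timeEvolution_apply_initial (hwf : M.IsWellFormed) (hnf : M.IsNormalForm)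
    {C D : PlainConfig Γ Q} (hC : C.state ≠ M.qf) (hD : D.state = M.q₀) :
    M.timeEvolution (ket C) D = 0 := by
  -- Since `|D⟩` is the column of `U_M` at a final `F`, the coordinate at `D` is an inner product of
  -- two distinct columns.
  obtain ⟨F, hF, hFD⟩ := hnf.exists_final hD
  rw [← inner_ket_left, ← hFD, hwf.inner_map_map, inner_ket_left, ket_apply, if_neg]
  rintro rfl
  exact hC hF

/-- The configurations other than the initial ones arise from non-final ones. -/
theorem exists_preimage_of_ne_initial (hwf : M.IsWellFormed) (hnf : M.IsNormalForm)
    {D : PlainConfig Γ Q} (hD : D.state ≠ M.q₀) :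
    ∃ χ, M.timeEvolution χ = ket D ∧ ∀ C, χ C ≠ 0 → C.state ≠ M.qf := by
  -- The coordinate of `U_M* |D⟩` at a final `C` is `⟨U_M C, D⟩`, where `U_M |C⟩` is an initial base
  -- vector and `D` is not initial.
  refine ⟨star M.timeEvolution (ket D), ?_, fun C hC hf => hC ?_⟩
  · rw [← mul_apply_eq_comp, (Unitary.mem_iff.1 hwf).2]
    rfl
  · rw [← inner_ket_left, ContinuousLinearMap.star_eq_adjoint,
      ContinuousLinearMap.adjoint_inner_right, hnf.timeEvolution_final hf, inner_ket_left,
      ket_apply, if_neg]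
    rintro rfl
    exact hD rfl

/-! ### Time evolution of the machine with counter -/

theorem toPreQTM_step_final {C : M.toPreQTM.Config} (hC : C.plain.state = M.qf) :
    M.toPreQTM.timeEvolution (ket C) = ket (C.incr hC) := by
  rw [PreQTM.timeEvolution_ket, PreQTM.step]
  exact dif_pos hC

theorem toPreQTM_step_counter {C : M.toPreQTM.Config} (hC : C.plain.state ≠ M.qf)
    (h0 : C.counter ≠ 0) : M.toPreQTM.timeEvolution (ket C) = ket C.decr := by
  rw [PreQTM.timeEvolution_ket, PreQTM.step]
  exact (dif_neg hC).trans (if_neg h0)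

/-- The terms of `U_M |C⟩` that enter `q₀` sum to zero, because `U_M |C⟩` has no initial part; so
the restricted transition function loses nothing. -/
theorem toPreQTM_step_zero (hwf : M.IsWellFormed) (hnf : M.IsNormalForm)
    {C : PlainConfig Γ Q} (hC : C.state ≠ M.qf) :
    M.toPreQTM.timeEvolution (ket (M.toPreQTM.zeroConfig C))
      = M.toPreQTM.embed (M.timeEvolution (ket C)) := by
  classical
  have h1 : M.toPreQTM.timeEvolution (ket (M.toPreQTM.zeroConfig C))
      = M.toPreQTM.embed (∑ x : {p // p ≠ M.q₀} × Γ × Dir,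
          M.δ C.state C.tape.head (x.1.1, x.2) • ket (C.next (x.1.1, x.2))) := by
    rw [PreQTM.timeEvolution_ket, PreQTM.step]
    refine (dif_neg hC).trans ((if_pos rfl).trans ?_)
    rw [map_sum]
    refine Finset.sum_congr rfl fun x _ => ?_
    rw [map_smul, PreQTM.embed, mapKet_ket]
    rfl
  have h2 : M.timeEvolution (ket C) = ∑ x : {p // p ≠ M.q₀} × Γ × Dir,
      M.δ C.state C.tape.head (x.1.1, x.2) • ket (C.next (x.1.1, x.2))
      + ∑ y : Γ × Dir, M.δ C.state C.tape.head (M.q₀, y) • ket (C.next (M.q₀, y)) := by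
    rw [timeEvolution_ket, step, Fintype.sum_prod_type, Fintype.sum_prod_type,
      ← Fintype.sum_subtype_add_sum_subtype (fun p => p ≠ M.q₀)]
    congr 1
    refine (Fintype.sum_eq_single (⟨M.q₀, by simp⟩ : {p // ¬ p ≠ M.q₀}) ?_)
    rintro ⟨p, hp⟩ hne
    exact absurd (Subtype.ext (not_not.1 hp)) hne
  rw [h1]
  congr 1
  -- Coordinates are compared rather than amplitudes: on a blank tape, moves to the left and to the
  -- right can lead to the same plain configuration.
  ext D
  by_cases hD : D.state = M.q₀
  · rw [timeEvolution_apply_initial hwf hnf hC hD, ← inner_ket_left, inner_sum]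
    refine Finset.sum_eq_zero fun x _ => ?_
    rw [inner_smul_right, inner_ket_left, ket_apply, if_neg, mul_zero]
    rintro rfl
    exact x.1.2 hD
  · rw [h2, ← inner_ket_left, ← inner_ket_left, inner_add_right]
    refine (add_eq_left.2 ?_).symm
    rw [inner_sum]
    refine Finset.sum_eq_zero fun y _ => ?_
    rw [inner_smul_right, inner_ket_left, ket_apply, if_neg, mul_zero]
    rintro rfl
    exact hD rfl

/-- On superpositions of non-final configurations, `M` and the machine with counter agree. -/
theorem toPreQTM_timeEvolution_embed (hwf : M.IsWellFormed) (hnf : M.IsNormalForm)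
    {χ : Hilb (PlainConfig Γ Q)} (hχ : ∀ C, χ C ≠ 0 → C.state ≠ M.qf) :
    M.toPreQTM.timeEvolution (M.toPreQTM.embed χ)
      = M.toPreQTM.embed (M.timeEvolution χ) := by
  refine apply_eq_of_support
    (T := M.toPreQTM.timeEvolution.comp M.toPreQTM.embed.toContinuousLinearMap)
    (T' := M.toPreQTM.embed.toContinuousLinearMap.comp M.timeEvolution) fun C hC => ?_
  have e : M.toPreQTM.embed (ket C) = ket (M.toPreQTM.zeroConfig C) := mapKet_ket _ _ _
  have := toPreQTM_step_zero hwf hnf (hχ C hC)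
  rw [← e] at this
  exact this

/-- Configurations are of three kinds: final, non-final with positive counter (hence initial), and
non-final with counter `0`. Within a kind the step is an injection of base vectors or inherits
isometry from `U_M`; different kinds have orthogonal images. -/
theorem inner_toPreQTM_timeEvolution (hwf : M.IsWellFormed) (hnf : M.IsNormalForm)
    (C D : M.toPreQTM.Config) :
    inner ℂ (M.toPreQTM.timeEvolution (ket C)) (M.toPreQTM.timeEvolution (ket D))
      = inner ℂ (ket C) (ket D : Hilb M.toPreQTM.Config) := by
  classical
  have zero_eq : ∀ {C : M.toPreQTM.Config}, C.counter = 0 →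
      C = M.toPreQTM.zeroConfig C.plain := fun h => PreQTM.Config.ext rfl h
  have final_other : ∀ {C D : M.toPreQTM.Config}, C.plain.state = M.qf → D.plain.state ≠ M.qf →
      inner ℂ (M.toPreQTM.timeEvolution (ket C)) (M.toPreQTM.timeEvolution (ket D))
        = inner ℂ (ket C) (ket D : Hilb M.toPreQTM.Config) := by
    intro C D hC hD
    rw [toPreQTM_step_final hC, inner_ket_left, inner_ket_left, ket_apply D, if_neg]
    · by_cases h0 : D.counter = 0
      · rw [zero_eq h0, toPreQTM_step_zero hwf hnf hD, embed_apply, if_neg]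
        -- The image of a final configuration has positive counter, whereas embedded vectors live on
        -- counter `0`.
        exact Nat.succ_ne_zero _
      · rw [toPreQTM_step_counter hD h0, ket_apply, if_neg]
        intro e
        have := congrArg (fun C => C.plain.state) e
        exact hD (this.symm.trans hC)
    · rintro rfl
      exact hD hC
  have counter_zero : ∀ {C D : M.toPreQTM.Config}, C.plain.state ≠ M.qf → C.counter ≠ 0 →
      D.plain.state ≠ M.qf → D.counter = 0 →
      inner ℂ (M.toPreQTM.timeEvolution (ket C)) (M.toPreQTM.timeEvolution (ket D))
        = inner ℂ (ket C) (ket D : Hilb M.toPreQTM.Config) := by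
    intro C D hC hC0 hD hD0
    rw [toPreQTM_step_counter hC hC0, inner_ket_left, inner_ket_left, ket_apply D, if_neg]
    · rw [zero_eq hD0, toPreQTM_step_zero hwf hnf hD, embed_apply]
      split_ifs
      · exact timeEvolution_apply_initial (D := C.plain) hwf hnf hD (state_eq_initial hC hC0)
      · rfl
    · rintro rfl
      exact hC0 hD0
  have symm : ∀ {C D : M.toPreQTM.Config},
      inner ℂ (M.toPreQTM.timeEvolution (ket C)) (M.toPreQTM.timeEvolution (ket D))
        = inner ℂ (ket C) (ket D : Hilb M.toPreQTM.Config) →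
      inner ℂ (M.toPreQTM.timeEvolution (ket D)) (M.toPreQTM.timeEvolution (ket C))
        = inner ℂ (ket D) (ket C : Hilb M.toPreQTM.Config) := by
    intro C D h
    rw [← inner_conj_symm, h, inner_conj_symm]
  by_cases hC : C.plain.state = M.qf <;> by_cases hD : D.plain.state = M.qf
  · rw [toPreQTM_step_final hC, toPreQTM_step_final hD, inner_ket_left, inner_ket_left, ket_apply,
      ket_apply]
    congr 1
    simp [PreQTM.Config.incr, PreQTM.Config.ext_iff]
  · exact final_other hC hD
  · exact symm (final_other hD hC)
  by_cases hC0 : C.counter = 0 <;> by_cases hD0 : D.counter = 0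
  · have e : ∀ C, ket (M.toPreQTM.zeroConfig C) = M.toPreQTM.embed (ket C) :=
      fun C => (mapKet_ket _ _ _).symm
    rw [zero_eq hC0, zero_eq hD0, toPreQTM_step_zero hwf hnf hC, toPreQTM_step_zero hwf hnf hD,
      LinearIsometry.inner_map_map, hwf.inner_map_map, e, e, LinearIsometry.inner_map_map]
  · exact symm (counter_zero hD hD0 hC hC0)
  · exact counter_zero hC hC0 hD hD0
  · rw [toPreQTM_step_counter hC hC0, toPreQTM_step_counter hD hD0, inner_ket_left,
      inner_ket_left, ket_apply, ket_apply]
    congr 1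
    simp only [PreQTM.Config.decr, PreQTM.Config.ext_iff, eq_iff_iff]
    refine and_congr_right fun _ => ?_
    -- Truncated subtraction is injective here because both counters are positive.
    omega

theorem exists_toPreQTM_preimage (hwf : M.IsWellFormed) (hnf : M.IsNormalForm)
    (D : M.toPreQTM.Config) : ∃ ψ, M.toPreQTM.timeEvolution ψ = ket D := by
  by_cases hD : D.plain.state = M.q₀
  · refine ⟨ket ⟨D.plain, D.counter + 1, fun h => absurd (Or.inl hD) h⟩, ?_⟩
    -- Every initial configuration, even with counter `0`, comes from the next higher counter.
    exact toPreQTM_step_counter (fun h => M.q₀_ne_qf (hD.symm.trans h)) (Nat.succ_ne_zero _)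
  by_cases h0 : D.counter = 0
  · obtain ⟨χ, hχ, hs⟩ := exists_preimage_of_ne_initial hwf hnf hD
    refine ⟨M.toPreQTM.embed χ, ?_⟩
    rw [toPreQTM_timeEvolution_embed hwf hnf hs, hχ, PreQTM.embed, mapKet_ket]
    congr 1
    exact PreQTM.Config.ext rfl h0.symm
  · have hf : D.plain.state = M.qf := by
      by_contra h
      exact hD (state_eq_initial h h0)
    refine ⟨ket D.decr, (toPreQTM_step_final (C := D.decr) hf).trans ?_⟩
    congr 1
    exact PreQTM.Config.ext rfl (Nat.succ_pred h0)

theorem toPreQTM_isQTM (hwf : M.IsWellFormed) (hnf : M.IsNormalForm) : M.toPreQTM.IsQTM :=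
  mem_unitary_of_ket (inner_toPreQTM_timeEvolution hwf hnf) (exists_toPreQTM_preimage hwf hnf)

/-! ### Agreement up to the halting time -/

/-- Until a final configuration occurs, `M` and the machine with counter evolve in the same way. -/
theorem toPreQTM_timeEvolution_pow (hwf : M.IsWellFormed) (hnf : M.IsNormalForm)
    {C : PlainConfig Γ Q} {k : ℕ} (hk : M.FirstFinal C k) {j : ℕ} (hj : j ≤ k) :
    (M.toPreQTM.timeEvolution ^ j) (ket (M.toPreQTM.zeroConfig C))
      = M.toPreQTM.embed ((M.timeEvolution ^ j) (ket C)) := by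
  induction j with
  | zero => exact (mapKet_ket _ _ _).symm
  | succ j ih =>
    rw [pow_succ', pow_succ', mul_apply_eq_comp, mul_apply_eq_comp,
      ih (by omega)]
    refine toPreQTM_timeEvolution_embed hwf hnf fun D hD hf => ?_
    -- A final configuration at time `j` would give `k ≤ j`, but `j + 1 ≤ k`. At time `k` itself
    -- final configurations may occur, as they are not evolved further.
    have := hk.2 ⟨D, hf, hD⟩
    omega

end BVMachine

end QTM

theorem mainTheorem4 {Γ Q : Type*} [Inhabited Γ] [Nontrivial Γ] [Fintype Γ] [Fintype Q]
    (M : QTM.BVMachine Γ Q) (hwf : M.IsWellFormed) (hst : M.IsStationary)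
    (hnf : M.IsNormalForm) :
    ∃ M' : QTM.PreQTM Γ Q,
      M'.IsQTM ∧
      M'.Qs = {M.q₀} ∧ M'.Qt = {M.qf} ∧ M'.qi = M.q₀ ∧ M'.qf = M.qf ∧
      (∀ (q : {q // q ∉ M'.Qt}) (a : Γ) (p : {p // p ∉ M'.Qs}) (b : Γ) (d : Turing.Dir),
        M'.δ₀ q a (p, b, d) = M.δ q.1 a (p.1, b, d)) ∧
      ∀ (C : QTM.PlainConfig Γ Q) (k : ℕ) (φ : QTM.Hilb (QTM.PlainConfig Γ Q)),
        C.state = M.q₀ → M.HaltsIn C k φ →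
          (M'.timeEvolution ^ k) (QTM.ket (M'.zeroConfig C)) = M'.embed φ := by
  refine ⟨M.toPreQTM, QTM.BVMachine.toPreQTM_isQTM hwf hnf, rfl, rfl, rfl, rfl,
    fun _ _ _ _ _ => rfl, ?_⟩
  rintro C k φ - ⟨hk, rfl, -⟩
  exact QTM.BVMachine.toPreQTM_timeEvolution_pow hwf hnf hk le_rfl
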